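/- Lemma 6.1. For a group $G$ and a subset $X\subseteq G$, let $\mathrm{WP}(G,X)$ denote the set of words in $(X\cup X^{-1})^*$ that equal the identity of $G$. A language is multiple context-free if, for some $k\ge 1$, it is generated by a multiple context-free grammar all of whose non-terminals have rank at most $k$ (in the rules $A(s_1,\dots,s_m)\leftarrow B_1(x^1_1,\dots,x^1_{k_1}),\dots,B_n(x^n_1,\dots,x^n_{k_n})$ each variable occurs at most once in $s_1\cdots s_m$). Let $G$ be a finitely generated group, and suppose that $\mathrm{WP}(G,X)$ is multiple context-free for some finite generating set $X$ of $G$. Then the following hold. 1. (Rational subset membership.) For every finite alphabet $\Sigma$ and every surjective monoid homomorphism $\pi:\Sigma^*\to G$, the following problem is decidable: given a finite state automaton over $\Sigma$ accepting a language $L$, and a word $w\in\Sigma^*$, decide whether $\pi(w)\in\pi(L)$. 2. (Rational subset intersection.) For every finite alphabet $\Sigma$ and every surjective monoid homomorphism $\pi:\Sigma^*\to G$, the following problem is decidable: given two finite state automata over $\Sigma$ accepting languages $L_1$ and $L_2$, decide whether $\pi(L_1)\cap\pi(L_2)=\emptyset$. 3. (Regular intersection with the word problem.) For every finite generating set $Y$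 of $G$, the following problem is decidable: given a finite state automaton over $Y\cup Y^{-1}$ accepting a language $L_1$, decide whether $\mathrm{WP}(G,Y)\cap L_1\neq\emptyset$. -/

import Mathlib

/-! ### Multiple context-free grammars -/

/-- A rule `A(s₁,…,sₘ) ← B₁(x₁¹,…), …, Bₙ(x₁ⁿ,…)` over terminals `T` and non-terminals `N` with
ranks `rank`.  The variable `xⱼⁱ` is the pair `⟨i, j⟩`; the strings `s₁,…,sₘ` consist of terminals
and variables.  The case `arity = 0` is the case of an initialising rule `A(t₁,…,tₘ) ←`. -/
structure MCFRule (T N : Type*) (rank : N → ℕ) where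
  /-- the non-terminal `A` -/
  lhs : N
  /-- the number `n` of non-terminals on the right -/
  arity : ℕ
  /-- the non-terminals `B₁,…,Bₙ` -/
  rhs : Fin arity → N
  /-- the strings `s₁,…,sₘ` -/
  strings : Fin (rank lhs) → List (T ⊕ (Σ i : Fin arity, Fin (rank (rhs i))))
  /-- each variable is used at most once in the concatenation `s₁⋯sₘ` -/
  linear : ((List.ofFn strings).flatten.filterMap Sum.getRight?).Nodup

/-- A multiple context-free grammar with terminals `T`. -/
structure MCFGrammar (T : Type*) where
  /-- the non-terminals -/
  NT : Type
  /-- there are finitely many non-terminals -/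
  finite_NT : Finite NT
  /-- the rank (number of variables) of a non-terminal -/
  rank : NT → ℕ
  rank_pos : ∀ A, 1 ≤ rank A
  /-- the start non-terminal `S` -/
  initial : NT
  rank_initial : rank initial = 1
  /-- the finite set of rules -/
  rules : Finset (MCFRule T NT rank)

namespace MCFGrammar

variable {T : Type*} (g : MCFGrammar T)

/-- `g.Derives A u`: the tuple of words `u` is obtained as a value of the non-terminal `A` by
finitely many applications of rules, working from the leaves of a derivation tree to its root.
Applying a rule replaces, in each `sⱼ`, the variable `⟨i, l⟩` by the `l`-th entry of a value `u i`
already obtained for `Bᵢ`. -/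
inductive Derives : (A : g.NT) → (Fin (g.rank A) → List T) → Prop
  | apply (r : MCFRule T g.NT g.rank) (hr : r ∈ g.rules)
      (u : (i : Fin r.arity) → Fin (g.rank (r.rhs i)) → List T)
      (hu : ∀ i, Derives (r.rhs i) (u i)) :
      Derives r.lhs
        (fun j => (r.strings j).flatMap (Sum.elim (fun a => [a]) (fun x => u x.1 x.2)))

/-- The language of a grammar: all words `w` for which `S(w)` can be obtained. -/
def language : Language T := {w | g.Derives g.initial (fun _ => w)}

end MCFGrammar

/-- `L` is `k`-multiple context-free. -/
def Language.IsKMultipleContextFree {T : Type*} (k : ℕ) (L : Language T) : Prop :=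
  ∃ g : MCFGrammar T, (∀ A, g.rank A ≤ k) ∧ g.language = L

/-- `L` is multiple context-free. -/
def Language.IsMultipleContextFree {T : Type*} (L : Language T) : Prop :=
  ∃ k : ℕ, 1 ≤ k ∧ L.IsKMultipleContextFree k

/-! ### Finite state automata as inputs of algorithms -/

/-- A (nondeterministic) finite state automaton over the alphabet `α`, as a finite piece of data:
the states are `0, …, numStates - 1`; a triple `(p, some a, q)` in `trans` is an edge from `p` to
`q` labelled `a`, a triple `(p, none, q)` is an edge labelled by the empty word. -/
structure FSA (α : Type*) where
  numStates : ℕ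
  start : List ℕ
  accept : List ℕ
  trans : List (ℕ × Option α × ℕ)

namespace FSA

/-- A finite state automaton is a tuple of its four components. -/
def equivProd (α : Type*) :
    FSA α ≃ ℕ × List ℕ × List ℕ × List (ℕ × Option α × ℕ) where
  toFun A := (A.numStates, A.start, A.accept, A.trans)
  invFun t := ⟨t.1, t.2.1, t.2.2.1, t.2.2.2⟩
  left_inv _ := rfl
  right_inv _ := rfl

instance (α : Type*) [Primcodable α] : Primcodable (FSA α) :=
  Primcodable.ofEquiv _ (equivProd α)

variable {α : Type*}

/-- The automaton described by the data, with finite state set `Fin A.numStates`. -/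
def toεNFA (A : FSA α) : εNFA α (Fin A.numStates) where
  step p a := {q | ((p : ℕ), a, (q : ℕ)) ∈ A.trans}
  start := {q | (q : ℕ) ∈ A.start}
  accept := {q | (q : ℕ) ∈ A.accept}

/-- The language accepted by the automaton. -/
def language (A : FSA α) : Language α := A.toεNFA.accepts

end FSA

/-! ### Word problems and decision problems -/

/-- The word problem `WP(G, X)`: the words over `X ∪ X⁻¹` that equal the identity in `G`. -/
def wordProblem {G : Type*} [Group G] (X : Set G) : Language ↥(X ∪ X⁻¹) :=
  {w | (w.map Subtype.val).prod = 1}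

/-- The monoid homomorphism `Σ* → M` that extends a map `π : Σ → M` on letters. -/
def wordValue {M α : Type*} [Monoid M] (π : α → M) (w : List α) : M := (w.map π).prod

/-- The map `π : Σ → M` on letters extends to a generating map: `Σ* → M` is onto. -/
def IsGeneratingMap {M α : Type*} [Monoid M] (π : α → M) : Prop :=
  Function.Surjective (wordValue π)

/-- Given an automaton for `L` and a word `w`, it is decidable whether `π(w) ∈ π(L)`. -/
def DecidableRationalMembership {M α : Type*} [Monoid M] [Primcodable α] (π : α → M) : Prop :=
  ComputablePred fun p : FSA α × List α => wordValue π p.2 ∈ wordValue π '' p.1.language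

/-- Given automata for `L₁` and `L₂`, it is decidable whether `π(L₁) ∩ π(L₂) = ∅`. -/
def DecidableRationalIntersection {M α : Type*} [Monoid M] [Primcodable α] (π : α → M) : Prop :=
  ComputablePred fun p : FSA α × FSA α =>
    wordValue π '' p.1.language ∩ wordValue π '' p.2.language = ∅

/-- Given an automaton for `L₁`, it is decidable whether `L ∩ L₁` is non-empty. -/
def DecidableRegularIntersection {α : Type*} [Primcodable α] (L : Language α) : Prop :=
  ComputablePred fun A : FSA α => ∃ w, w ∈ L ∧ w ∈ A.language

/-! ### Primitive recursive relations -/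

/-! Two words have the same value iff the value of `u` times the inverse of the value of `v` is
trivial. Once letters are replaced by words over `X ∪ X⁻¹`, all pairs of words from two automata are
read along the paths of one finite labelled graph (`pairGraph`). Up to negation, each of the three
problems therefore asks whether the word problem for `X` contains a path label
(`exists_mem_pathLanguage_pairGraph_iff`). It remains to decide, for a fixed multiple context-free
language `L` and a given graph with path language `R`, whether `L` meets `R`.

Both this property and its negation are recursively enumerable. A common word is found by
enumerating derivations and paths. Disjointness has a finite certificate: a finite transformation
monoid, a set of values closed under the edges of the graph, and a set of tuples of values closed
under the rules of the grammar, with no value shared by the accepting vertices and the start symbol.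
Closedness forces the two sets to contain the values of all path labels and all derived tuples, so a
certificate proves disjointness. Conversely, `R` is regular (`isRegular_pathLanguage`), hence
recognised by the transition monoid of a finite automaton, and the exact sets of values in that
monoid form a certificate. No bound on its size is needed. -/

theorem REPred.exists_of_primrecRel {α γ : Type*} [Primcodable α] [Primcodable γ]
    {R : α → γ → Prop} (hR : PrimrecRel R) : REPred fun a => ∃ c, R a c := by
  classical
  -- The search runs over codes of witnesses; a number that encodes nothing counts as a failure.
  have hf : Primrec₂ fun (a : α) (n : ℕ) =>
      ((Encodable.decode (α := γ) n).map fun c => decide (R a c)).getD false :=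
    Primrec.option_getD.comp
      (Primrec.option_map (Primrec.decode.comp Primrec.snd)
        (hR.decide.comp (Primrec.fst.comp Primrec.fst) Primrec.snd).to₂)
      (Primrec.const false)
  have h : Partrec fun a : α => Nat.rfind fun n => Part.some
      (((Encodable.decode (α := γ) n).map fun c => decide (R a c)).getD false) :=
    Partrec.rfind (p := fun (a : α) (n : ℕ) => (Part.some
      (((Encodable.decode (α := γ) n).map fun c => decide (R a c)).getD false) : Part Bool))
      hf.to_comp.partrec₂
  refine h.dom_re.of_eq fun a => ?_
  refine Nat.rfind_dom.trans ?_
  constructor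
  · rintro ⟨n, hn, -⟩
    rw [Part.mem_some_iff] at hn
    rcases hc : (Encodable.decode (α := γ) n) with _ | c
    · simp [hc] at hn
    · exact ⟨c, by simpa [hc] using hn⟩
  · rintro ⟨c, hc⟩
    exact ⟨Encodable.encode c, by simp [hc], fun _ => trivial⟩

theorem PrimrecRel.list_mem {α : Type*} [Primcodable α] :
    PrimrecRel fun (a : α) (l : List α) => a ∈ l := by
  have h : PrimrecRel fun (l : List α) (a : α) => ∃ b ∈ l, b = a :=
    PrimrecRel.exists_mem_list (R := fun b a : α => b = a) Primrec.eq
  exact (h.comp Primrec.snd Primrec.fst).of_eq fun p => by simp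

theorem PrimrecRel.list_subset {α : Type*} [Primcodable α] :
    PrimrecRel fun (l l' : List α) => l ⊆ l' :=
  PrimrecRel.list_mem.forall_mem_list

/-! ### Lists of values attached to keys -/

section Values

variable {κ β : Type*} [DecidableEq κ]

/-- The values attached to the key `k` in an association list. -/
def List.valuesAt (F : List (κ × β)) (k : κ) : List β :=
  (F.filter fun x => x.1 = k).map Prod.snd

@[simp] theorem List.mem_valuesAt {F : List (κ × β)} {k : κ} {b : β} :
    b ∈ F.valuesAt k ↔ (k, b) ∈ F := by
  simp only [List.valuesAt, List.mem_map, List.mem_filter, decide_eq_true_eq]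
  constructor
  · rintro ⟨⟨k', b'⟩, ⟨h, rfl⟩, rfl⟩
    exact h
  · exact fun h => ⟨(k, b), ⟨h, rfl⟩, rfl⟩

theorem Primrec.list_valuesAt [Primcodable κ] [Primcodable β] :
    Primrec₂ (List.valuesAt : List (κ × β) → κ → List β) := by
  have h : Primrec₂ fun (F : List (κ × β)) (k : κ) => F.filter fun x => x.1 = k :=
    PrimrecRel.listFilter (R := fun (x : κ × β) (k : κ) => x.1 = k)
      (Primrec.eq.comp (Primrec.fst.comp Primrec.fst) Primrec.snd)
  exact Primrec.list_map h (Primrec.snd.comp Primrec.snd).to₂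

/-- All ways to choose, for each `i`, a value attached to the key `k i`. -/
def List.choices (F : List (κ × β)) : (n : ℕ) → (Fin n → κ) → List (List β)
  | 0, _ => [[]]
  | n + 1, k => (F.valuesAt (k 0)).flatMap fun b =>
      (F.choices n fun i => k i.succ).map fun l => b :: l

theorem List.mem_choices {F : List (κ × β)} {n : ℕ} {k : Fin n → κ} {l : List β} :
    l ∈ F.choices n k ↔ ∃ v : Fin n → β, l = List.ofFn v ∧ ∀ i, (k i, v i) ∈ F := by
  induction n generalizing l with
  | zero => simp [List.choices]
  | succ n ih =>
    simp only [List.choices, List.mem_flatMap, List.mem_valuesAt, List.mem_map, ih]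
    constructor
    · rintro ⟨b, hb, l, ⟨v, rfl, hv⟩, rfl⟩
      exact ⟨Fin.cons b v, by simp [List.ofFn_succ], Fin.cases hb hv⟩
    · rintro ⟨v, rfl, hv⟩
      exact ⟨v 0, hv 0, _, ⟨fun i => v i.succ, rfl, fun i => hv i.succ⟩, by simp [List.ofFn_succ]⟩

theorem Primrec.list_choices [Primcodable κ] [Primcodable β] (n : ℕ) (k : Fin n → κ) :
    Primrec fun F : List (κ × β) => F.choices n k := by
  induction n with
  | zero => exact Primrec.const _
  | succ n ih =>
    refine Primrec.list_flatMap (Primrec.list_valuesAt.comp Primrec.id (Primrec.const _)) ?_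
    exact Primrec.list_map ((ih _).comp Primrec.fst)
      (Primrec.list_cons.comp (Primrec.snd.comp Primrec.fst) Primrec.snd).to₂

end Values

/-! ### Interpreting words in a set with a multiplication -/

/-- The product of the values of the letters of a word. -/
def wordInterp {T β : Type*} (σ : T → β) (e : β) (m : β → β → β) (w : List T) : β :=
  w.foldr (fun t b => m (σ t) b) e

section Interp

variable {P T β : Type*} [Primcodable P] [Primcodable T] [Primcodable β]

/-- Letterwise recursiveness of `σ` suffices, because dependence on a letter of a finite alphabet is
a finite case distinction. -/
theorem Primrec.wordInterp [Finite T] {σ : P → T → β} {e : P → β} {m : β → β → β}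
    (hσ : ∀ t, Primrec fun p => σ p t) (he : Primrec e) (hm : Primrec₂ m) :
    Primrec₂ fun p w => wordInterp (σ p) (e p) m w := by
  have hσ' : Primrec₂ σ := by
    have h : Primrec₂ fun (t : T) (p : P) => σ p t := by
      obtain ⟨n, ⟨f⟩⟩ := Finite.exists_equiv_fin T
      have h' : Primrec₂ fun (i : Fin n) (p : P) => σ p (f.symm i) :=
        Primrec.fin_curry₁.2 fun i => hσ _
      exact (h'.comp (((Primrec.dom_finite f).comp Primrec.fst)) Primrec.snd).of_eq
        fun x => by simp
    exact h.swap
  exact Primrec.list_foldr Primrec.snd (he.comp Primrec.fst)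
    (hm.comp (hσ'.comp (Primrec.fst.comp Primrec.fst) (Primrec.fst.comp Primrec.snd))
      (Primrec.snd.comp Primrec.snd)).to₂

end Interp

/-! ### Paths in graphs labelled by words -/

/-- The edge list `E` contains a path from `p` to `q` labelled by a given word. -/
inductive LabelledPath {V T : Type*} (E : List (V × List T × V)) : V → List T → V → Prop
  | nil (p : V) : LabelledPath E p [] p
  | snoc {p q r : V} {w u : List T} (h : LabelledPath E p w q) (hu : (q, u, r) ∈ E) :
      LabelledPath E p (w ++ u) r

namespace LabelledPath

variable {V T : Type*} {E : List (V × List T × V)}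

theorem cons {p q r : V} {u w : List T} (hu : (p, u, q) ∈ E) (h : LabelledPath E q w r) :
    LabelledPath E p (u ++ w) r := by
  induction h with
  | nil => simpa using (nil (E := E) p).snoc hu
  | snoc h hu' ih => rw [← List.append_assoc]; exact ih.snoc hu'

theorem trans {p q r : V} {u w : List T} (h : LabelledPath E p u q) (h' : LabelledPath E q w r) :
    LabelledPath E p (u ++ w) r := by
  induction h' with
  | nil => simpa using h
  | snoc h' hu ih => rw [← List.append_assoc]; exact ih.snoc hu

/-- A path can be cut at any position of its label, up to a piece of the label of one edge. -/
theorem exists_split {p f : V} {x : List T} (h : LabelledPath E p x f) {z r : List T}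
    (hx : x = z ++ r) : ∃ q s r', LabelledPath E p (z ++ s) q ∧ LabelledPath E q r' f ∧
      r = s ++ r' ∧ (s = [] ∨ ∃ a ∈ E, s <:+ a.2.1) := by
  induction h generalizing r with
  | nil =>
    obtain ⟨rfl, rfl⟩ := List.append_eq_nil_iff.1 hx.symm
    exact ⟨_, [], [], nil _, nil _, rfl, Or.inl rfl⟩
  | @snoc q' f w u h hu ih =>
    rcases List.append_eq_append_iff.1 hx with ⟨s, hz, hs⟩ | ⟨s, hz, hs⟩
    · refine ⟨f, r, [], ?_, nil _, by simp, Or.inr ⟨_, hu, ⟨s, hs.symm⟩⟩⟩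
      rw [← hx]
      exact h.snoc hu
    · obtain ⟨q, s', r', h₁, h₂, rfl, h₃⟩ := ih hz
      refine ⟨q, s', r' ++ u, h₁, h₂.snoc hu, ?_, h₃⟩
      rw [hs, List.append_assoc]

end LabelledPath

/-- The set of labels of paths from a vertex in `st` to a vertex in `ac`. -/
def pathLanguage {V T : Type*} (E : List (V × List T × V)) (st ac : List V) : Language T :=
  {w | ∃ p ∈ st, ∃ q ∈ ac, LabelledPath E p w q}

/-- Myhill–Nerode: the left quotient by `z` depends only on which pairs (vertex `q`, unread rest `s`
of an edge label) are reachable by reading `z`. Although `V` may be infinite, only start vertices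
and edge targets occur, so there are finitely many such pairs. -/
theorem isRegular_pathLanguage {V T : Type*} (E : List (V × List T × V)) (st ac : List V) :
    (pathLanguage E st ac).IsRegular := by
  rw [Language.isRegular_iff_finite_range_leftQuotient]
  let C : Set V := {q | q ∈ st ∨ ∃ a ∈ E, q = a.2.2}
  let S : Set (List T) := {s | s = [] ∨ ∃ a ∈ E, s <:+ a.2.1}
  have hC : C.Finite := by
    refine ((st.finite_toSet).union ((E.map fun a => a.2.2).finite_toSet)).subset ?_
    rintro q (hq | ⟨a, ha, rfl⟩)
    · exact Or.inl hq
    · exact Or.inr (List.mem_map.2 ⟨a, ha, rfl⟩)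
  have hS : S.Finite := by
    refine (([] :: E.flatMap fun a => a.2.1.tails).finite_toSet).subset ?_
    rintro s (rfl | ⟨a, ha, hs⟩)
    · simp
    · exact List.mem_cons_of_mem _ (List.mem_flatMap.2 ⟨a, ha, (List.mem_tails _ _).2 hs⟩)
  have hCpath : ∀ {p x q}, p ∈ st → LabelledPath E p x q → q ∈ C := by
    intro p x q hp h
    cases h with
    | nil => exact Or.inl hp
    | snoc h hu => exact Or.inr ⟨_, hu, rfl⟩
  -- `K A` consists of the words that lead from some pair in `A` to acceptance.
  let K : Set (V × List T) → Language T := fun A =>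
    {r | ∃ a ∈ A, ∃ r', ∃ f ∈ ac, LabelledPath E a.1 r' f ∧ r = a.2 ++ r'}
  refine ((hC.prod hS).finite_subsets.image K).subset ?_
  rintro _ ⟨z, rfl⟩
  refine ⟨{a | a ∈ C ×ˢ S ∧ ∃ p ∈ st, LabelledPath E p (z ++ a.2) a.1}, fun a ha => ha.1, ?_⟩
  ext r
  rw [Language.mem_leftQuotient]
  constructor
  · rintro ⟨a, ⟨-, p, hp, h⟩, r', f, hf, h', rfl⟩
    exact ⟨p, hp, f, hf, by simpa using h.trans h'⟩
  · rintro ⟨p, hp, f, hf, h⟩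
    obtain ⟨q, s, r', h₁, h₂, rfl, h₃⟩ := h.exists_split rfl
    exact ⟨(q, s), ⟨⟨hCpath hp h₁, h₃⟩, p, hp, h₁⟩, r', f, hf, h₂, rfl⟩

section PathStep

variable {V T β : Type*} [DecidableEq V]

/-- One round of computing interpretations of path labels. -/
def pathStep (σ : T → β) (e : β) (m : β → β → β) (E : List (V × List T × V))
    (I : List (V × β)) : List (V × β) :=
  I ++ E.flatMap fun a => (I.valuesAt a.1).map fun b => (a.2.2, m b (wordInterp σ e m a.2.1))

theorem mem_pathStep {σ : T → β} {e : β} {m : β → β → β} {E : List (V × List T × V)}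
    {I : List (V × β)} {x : V × β} : x ∈ pathStep σ e m E I ↔ x ∈ I ∨
      ∃ p u q b, (p, u, q) ∈ E ∧ (p, b) ∈ I ∧ x = (q, m b (wordInterp σ e m u)) := by
  simp only [pathStep, List.mem_append, List.mem_flatMap, List.mem_map, List.mem_valuesAt]
  refine or_congr Iff.rfl ⟨?_, ?_⟩
  · rintro ⟨⟨p, u, q⟩, ha, b, hb, rfl⟩
    exact ⟨p, u, q, b, ha, hb, rfl⟩
  · rintro ⟨p, u, q, b, ha, hb, rfl⟩
    exact ⟨(p, u, q), ha, b, hb, rfl⟩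

theorem Primrec.pathStep {P : Type*} [Primcodable P] [Primcodable V] [Primcodable T]
    [Primcodable β] [Finite T] {σ : P → T → β} {e : P → β} {m : β → β → β}
    (hσ : ∀ t, Primrec fun p => σ p t) (he : Primrec e) (hm : Primrec₂ m) :
    Primrec fun x : P × List (V × List T × V) × List (V × β) =>
      _root_.pathStep (σ x.1) (e x.1) m x.2.1 x.2.2 := by
  refine Primrec.list_append.comp (Primrec.snd.comp Primrec.snd) ?_
  refine Primrec.list_flatMap (Primrec.fst.comp Primrec.snd) ?_
  refine Primrec.list_map (Primrec.list_valuesAt.comp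
    (Primrec.snd.comp (Primrec.snd.comp Primrec.fst)) (Primrec.fst.comp Primrec.snd)) ?_
  have ha : Primrec fun y : ((P × List (V × List T × V) × List (V × β)) × V × List T × V) × β =>
      y.1.2 := Primrec.snd.comp Primrec.fst
  exact (Primrec.pair (Primrec.snd.comp (Primrec.snd.comp ha)) (hm.comp Primrec.snd
    ((Primrec.wordInterp hσ he hm).comp (Primrec.fst.comp (Primrec.fst.comp Primrec.fst))
      (Primrec.fst.comp (Primrec.snd.comp ha))))).to₂

/-- Soundness of certificates: `I` need only be closed, and may contain superfluous pairs. -/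
theorem LabelledPath.mem_of_pathStep_subset {σ : T → β} {e : β} {m : β → β → β}
    (hm : ∀ u v, wordInterp σ e m (u ++ v) = m (wordInterp σ e m u) (wordInterp σ e m v))
    {E : List (V × List T × V)} {I : List (V × β)} (hI : pathStep σ e m E I ⊆ I) {p q : V}
    {w : List T} (h : LabelledPath E p w q) (hp : (p, e) ∈ I) : (q, wordInterp σ e m w) ∈ I := by
  induction h with
  | nil => exact hp
  | snoc h hu ih => exact hI (mem_pathStep.2 (Or.inr ⟨_, _, _, _, hu, ih, by rw [hm]⟩))

theorem exists_labelledPath_iff_mem_iterate_pathStep {σ : T → β} {e : β} {m : β → β → β}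
    (hm : ∀ u v, wordInterp σ e m (u ++ v) = m (wordInterp σ e m u) (wordInterp σ e m v))
    {E : List (V × List T × V)} {st : List V} {x : V × β} :
    (∃ k, x ∈ (pathStep σ e m E)^[k] (st.map fun p => (p, e))) ↔
      ∃ p ∈ st, ∃ w, LabelledPath E p w x.1 ∧ x.2 = wordInterp σ e m w := by
  constructor
  · rintro ⟨k, hk⟩
    induction k generalizing x with
    | zero =>
      obtain ⟨p, hp, rfl⟩ := List.mem_map.1 hk
      exact ⟨p, hp, [], .nil p, rfl⟩
    | succ k ih =>
      rw [Function.iterate_succ_apply', mem_pathStep] at hk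
      rcases hk with hk | ⟨p, u, q, b, hu, hb, rfl⟩
      · exact ih hk
      · obtain ⟨p₀, hp₀, w, h, rfl⟩ := ih hb
        exact ⟨p₀, hp₀, w ++ u, h.snoc hu, (hm _ _).symm⟩
  · rintro ⟨p, hp, w, h, hx⟩
    obtain ⟨q, b⟩ := x
    simp only at h hx
    subst hx
    induction h with
    | nil => exact ⟨0, List.mem_map.2 ⟨p, hp, rfl⟩⟩
    | snoc h hu ih =>
      obtain ⟨k, hk⟩ := ih
      refine ⟨k + 1, ?_⟩
      rw [Function.iterate_succ_apply', mem_pathStep]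
      exact Or.inr ⟨_, _, _, _, hu, hk, by rw [hm]⟩

end PathStep

theorem subset_iterate {α : Type*} {f : List α → List α} (hf : ∀ l, l ⊆ f l) {k n : ℕ}
    (h : k ≤ n) (l : List α) : f^[k] l ⊆ f^[n] l := by
  induction n, h using Nat.le_induction with
  | base => exact List.Subset.refl _
  | succ n _ ih => rw [Function.iterate_succ_apply']; exact List.Subset.trans ih (hf _)

/-! ### Bottom-up evaluation of a grammar in a set with a multiplication. -/

namespace MCFGrammar

variable {T β : Type*} (g : MCFGrammar T)

/-- The value of the left hand side of a rule at given values of the right hand side. -/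
def ruleInterp {N : Type*} {rank : N → ℕ} [Inhabited β] (σ : T → β) (e : β) (m : β → β → β)
    (r : MCFRule T N rank) (l : List (List β)) : N × List β :=
  (r.lhs, List.ofFn fun j =>
    wordInterp (Sum.elim σ fun x => (l.getD x.1 []).getD x.2 default) e m (r.strings j))

/-- Evaluation commutes with substitution of words. On tuples of the right lengths the default
values in `ruleInterp` are never reached. -/
theorem ruleInterp_ofFn {N : Type*} {rank : N → ℕ} [Inhabited β] {σ : T → β} {e : β}
    {m : β → β → β}
    (hm : ∀ u v, wordInterp σ e m (u ++ v) = m (wordInterp σ e m u) (wordInterp σ e m v))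
    (r : MCFRule T N rank) (u : (i : Fin r.arity) → Fin (rank (r.rhs i)) → List T) :
    ruleInterp σ e m r (List.ofFn fun i => List.ofFn fun j => wordInterp σ e m (u i j)) =
      (r.lhs, List.ofFn fun j => wordInterp σ e m
        ((r.strings j).flatMap (Sum.elim (fun a => [a]) fun x => u x.1 x.2))) := by
  refine Prod.ext rfl (congrArg List.ofFn (funext fun j => ?_))
  induction r.strings j with
  | nil => rfl
  | cons x s ih =>
    rcases x with t | ⟨i, j⟩
    · exact congrArg (m (σ t)) ih
    · rw [List.flatMap_cons, hm, ← ih]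
      refine congrArg (fun b => m b _) ?_
      simp

end MCFGrammar

namespace MCFGrammar

section Step

variable {T β : Type*} (g : MCFGrammar T) [DecidableEq g.NT] [Inhabited β]

/-- One round of computing interpretations of the values of the non-terminals. -/
noncomputable def step (σ : T → β) (e : β) (m : β → β → β) (F : List (g.NT × List β)) :
    List (g.NT × List β) :=
  F ++ g.rules.toList.flatMap fun r => (F.choices r.arity r.rhs).map (ruleInterp σ e m r)

variable {g} {σ : T → β} {e : β} {m : β → β → β}

theorem mem_step {F : List (g.NT × List β)} {x : g.NT × List β} :
    x ∈ g.step σ e m F ↔ x ∈ F ∨ ∃ r ∈ g.rules, ∃ v : Fin r.arity → List β,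
      (∀ i, (r.rhs i, v i) ∈ F) ∧ x = ruleInterp σ e m r (List.ofFn v) := by
  simp only [step, List.mem_append, List.mem_flatMap, Finset.mem_toList, List.mem_map,
    List.mem_choices]
  refine or_congr Iff.rfl ⟨?_, ?_⟩
  · rintro ⟨r, hr, _, ⟨v, rfl, hv⟩, rfl⟩
    exact ⟨r, hr, v, hv, rfl⟩
  · rintro ⟨r, hr, v, hv, rfl⟩
    exact ⟨r, hr, _, ⟨v, rfl, hv⟩, rfl⟩

variable (hm : ∀ u v, wordInterp σ e m (u ++ v) = m (wordInterp σ e m u) (wordInterp σ e m v))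
include hm

theorem Derives.mem_step_of_rule {F : List (g.NT × List β)} {r : MCFRule T g.NT g.rank}
    (hr : r ∈ g.rules) {u : (i : Fin r.arity) → Fin (g.rank (r.rhs i)) → List T}
    (hu : ∀ i, (r.rhs i, List.ofFn fun j => wordInterp σ e m (u i j)) ∈ F) :
    (r.lhs, List.ofFn fun j => wordInterp σ e m
      ((r.strings j).flatMap (Sum.elim (fun a => [a]) fun x => u x.1 x.2))) ∈ g.step σ e m F :=
  mem_step.2 (Or.inr ⟨r, hr, _, hu, (ruleInterp_ofFn hm r u).symm⟩)

theorem Derives.mem_of_step_subset {F : List (g.NT × List β)} (hF : g.step σ e m F ⊆ F)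
    {A : g.NT} {u : Fin (g.rank A) → List T} (h : g.Derives A u) :
    (A, List.ofFn fun j => wordInterp σ e m (u j)) ∈ F := by
  induction h with
  | apply r hr u hu ih => exact hF (mem_step_of_rule hm hr ih)

theorem exists_derives_of_mem_step {F : List (g.NT × List β)}
    (hF : ∀ x ∈ F, ∃ A u, g.Derives A u ∧ x = (A, List.ofFn fun j => wordInterp σ e m (u j)))
    {x : g.NT × List β} (hx : x ∈ g.step σ e m F) :
    ∃ A u, g.Derives A u ∧ x = (A, List.ofFn fun j => wordInterp σ e m (u j)) := by
  rcases mem_step.1 hx with hx | ⟨r, hr, v, hv, rfl⟩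
  · exact hF x hx
  · have h : ∀ i, ∃ u, g.Derives (r.rhs i) u ∧
        v i = List.ofFn fun j => wordInterp σ e m (u j) := by
      intro i
      obtain ⟨A, u, hu, h⟩ := hF _ (hv i)
      obtain ⟨rfl, h⟩ := Prod.mk.inj h
      exact ⟨u, hu, h⟩
    choose u hu hv using h
    refine ⟨r.lhs, _, .apply r hr u hu, ?_⟩
    rw [← ruleInterp_ofFn hm, funext hv]

theorem exists_derives_iff_mem_iterate_step {x : g.NT × List β} :
    (∃ k, x ∈ (g.step σ e m)^[k] []) ↔
      ∃ A u, g.Derives A u ∧ x = (A, List.ofFn fun j => wordInterp σ e m (u j)) := by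
  constructor
  · rintro ⟨k, hk⟩
    induction k generalizing x with
    | zero => simp at hk
    | succ k ih =>
      rw [Function.iterate_succ_apply'] at hk
      exact exists_derives_of_mem_step hm (fun y => ih) hk
  · rintro ⟨A, u, h, rfl⟩
    induction h with
    | apply r hr u hu ih =>
      choose k hk using ih
      -- The finitely many premises all appear by the largest of their stages, since stages
      -- increase.
      refine ⟨Finset.univ.sup k + 1, ?_⟩
      rw [Function.iterate_succ_apply']
      exact Derives.mem_step_of_rule hm hr fun i => subset_iterate
        (fun F x hx => mem_step.2 (Or.inl hx)) (Finset.le_sup (Finset.mem_univ i)) _ (hk i)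

omit [DecidableEq g.NT] [Inhabited β] hm in
-- With finitely many values, finitely many non-terminals and fixed ranks, only finitely many tuples
-- can occur. Existence of the list is all that certificates require.
theorem exists_list_mem_iff_derives (hfin : (Set.range (wordInterp σ e m)).Finite) :
    ∃ F : List (g.NT × List β), ∀ x, x ∈ F ↔
      ∃ A u, g.Derives A u ∧ x = (A, List.ofFn fun j => wordInterp σ e m (u j)) := by
  have := hfin.to_subtype
  have := g.finite_NT
  have h : {x : g.NT × List β | ∃ A u, g.Derives A u ∧
      x = (A, List.ofFn fun j => wordInterp σ e m (u j))}.Finite := by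
    refine (Set.finite_range fun y : Σ A : g.NT, Fin (g.rank A) →
      Set.range (wordInterp σ e m) => (y.1, List.ofFn fun j => (y.2 j : β))).subset ?_
    rintro _ ⟨A, u, -, rfl⟩
    exact ⟨⟨A, fun j => ⟨_, u j, rfl⟩⟩, rfl⟩
  exact ⟨h.toFinset.toList, fun x => by simp⟩

omit hm

theorem _root_.Primrec.ruleInterp {N P : Type*} {rank : N → ℕ} [Primcodable P] [Primcodable N]
    [Primcodable β] {σ : P → T → β} {e : P → β} {m : β → β → β}
    (hσ : ∀ t, Primrec fun p => σ p t) (he : Primrec e) (hm : Primrec₂ m)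
    (r : MCFRule T N rank) :
    Primrec₂ fun p (l : List (List β)) => ruleInterp (σ p) (e p) m r l := by
  refine Primrec.pair (Primrec.const _) (Primrec.list_ofFn fun j => ?_)
  induction r.strings j with
  | nil => exact he.comp Primrec.fst
  | cons x s ih =>
    refine hm.comp ?_ ih
    rcases x with t | ⟨i, j⟩
    · exact (hσ t).comp Primrec.fst
    · exact (Primrec.list_getD _).comp
        ((Primrec.list_getD _).comp Primrec.snd (Primrec.const _)) (Primrec.const _)

/-- The grammar is fixed, so its rules are constants: the induction over the list of rules takes
place outside the computation. -/
theorem _root_.Primrec.mcfGrammar_step {P : Type*} [Primcodable P] [Primcodable g.NT]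
    [Primcodable β] {σ : P → T → β} {e : P → β} {m : β → β → β}
    (hσ : ∀ t, Primrec fun p => σ p t) (he : Primrec e) (hm : Primrec₂ m) :
    Primrec₂ fun p (F : List (g.NT × List β)) => g.step (σ p) (e p) m F := by
  refine Primrec.list_append.comp Primrec.snd ?_
  induction g.rules.toList with
  | nil => exact Primrec.const []
  | cons r l ih =>
    simp only [List.flatMap_cons]
    exact Primrec.list_append.comp (Primrec.list_map
      ((Primrec.list_choices _ _).comp Primrec.snd)
      ((Primrec.ruleInterp hσ he hm r).comp (Primrec.fst.comp Primrec.fst) Primrec.snd).to₂) ih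

end Step

end MCFGrammar

/-! ### Transformations of `{0, …, n - 1}` given by tables -/

/-- The transformation of `{0, …, n - 1}` with a given table of values, as a list. -/
def tableMap (n : ℕ) (l : List ℕ) : List ℕ :=
  (List.range n).map fun i => l.getD i 0 % n

/-- Composition of transformations given as lists. -/
def tableComp (a b : List ℕ) : List ℕ := a.map fun i => b.getD i 0

theorem wordInterp_tableMap {T : Type*} (n : ℕ) (δ : T → List ℕ) (w : List T) :
    wordInterp (fun t => tableMap n (δ t)) (List.range n) tableComp w =
      (List.range n).map fun i => w.foldl (fun i t => (δ t).getD i 0 % n) i := by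
  induction w with
  | nil => exact (List.map_id' _).symm
  | cons t w ih =>
    change tableComp _ (wordInterp _ _ _ w) = _
    rw [ih]
    simp only [tableComp, tableMap, List.map_map]
    refine List.map_congr_left fun i hi => ?_
    have hn : (δ t).getD i 0 % n < n := Nat.mod_lt _ (Nat.zero_lt_of_lt (List.mem_range.1 hi))
    simp only [Function.comp_apply, List.foldl_cons]
    generalize (δ t).getD i 0 % n = k at hn
    simp [hn]

theorem foldl_table_lt {T : Type*} {n i : ℕ} (δ : T → List ℕ) (u : List T) (hi : i < n) :
    u.foldl (fun i t => (δ t).getD i 0 % n) i < n := by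
  induction u using List.reverseRecOn with
  | nil => exact hi
  | append_singleton u t _ => simpa using Nat.mod_lt _ (Nat.zero_lt_of_lt hi)

/-- Reduction modulo `n` turns arbitrary lists into transformations, so this holds for every table.
A certificate may thus contain any numbers without a validity check. -/
theorem wordInterp_tableMap_append {T : Type*} (n : ℕ) (δ : T → List ℕ) (u v : List T) :
    wordInterp (fun t => tableMap n (δ t)) (List.range n) tableComp (u ++ v) =
      tableComp (wordInterp (fun t => tableMap n (δ t)) (List.range n) tableComp u)
        (wordInterp (fun t => tableMap n (δ t)) (List.range n) tableComp v) := by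
  simp only [wordInterp_tableMap, tableComp, List.map_map]
  refine List.map_congr_left fun i hi => ?_
  have hn := foldl_table_lt δ u (List.mem_range.1 hi)
  simp only [Function.comp_apply, List.foldl_append]
  generalize u.foldl (fun i t => (δ t).getD i 0 % n) i = k at hn
  simp [hn]

theorem finite_range_wordInterp_tableMap {T : Type*} (n : ℕ) (δ : T → List ℕ) :
    (Set.range (wordInterp (fun t => tableMap n (δ t)) (List.range n) tableComp)).Finite := by
  refine (Set.finite_range fun f : Fin n → Fin n => List.ofFn fun i => (f i : ℕ)).subset ?_
  rintro _ ⟨w, rfl⟩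
  refine ⟨fun i => ⟨_, foldl_table_lt δ w i.2⟩, ?_⟩
  rw [wordInterp_tableMap]
  exact List.ext_getElem (by simp) (by simp)

/-- The transformation induced by a word on the states of a DFA determines where the start state is
sent, hence acceptance. -/
theorem Language.IsRegular.exists_table {T : Type*} {L : Language T} (hL : L.IsRegular) :
    ∃ (n : ℕ) (δ : T → List ℕ), ∀ u v,
      wordInterp (fun t => tableMap n (δ t)) (List.range n) tableComp u =
        wordInterp (fun t => tableMap n (δ t)) (List.range n) tableComp v → (u ∈ L ↔ v ∈ L) := by
  obtain ⟨Q, _, M, rfl⟩ := hL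
  obtain ⟨n, ⟨f⟩⟩ := Finite.exists_equiv_fin Q
  have hn : 0 < n := (f M.start).pos
  refine ⟨n, fun t => List.ofFn fun i => (f (M.step (f.symm i) t) : ℕ), fun u v huv => ?_⟩
  have key : ∀ (w : List T) (q : Q), w.foldl (fun i t =>
      (List.ofFn fun i => (f (M.step (f.symm i) t) : ℕ)).getD i 0 % n) (f q) =
      f (M.evalFrom q w) := by
    intro w
    induction w with
    | nil => intro q; rfl
    | cons t w ih =>
      intro q
      rw [List.foldl_cons, DFA.evalFrom_cons, ← ih]
      congr 1
      simp [Nat.mod_eq_of_lt]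
  rw [wordInterp_tableMap, wordInterp_tableMap, List.map_inj_left] at huv
  have h := huv (f M.start) (List.mem_range.2 (f M.start).2)
  rw [key, key, Fin.val_inj, f.apply_eq_iff_eq] at h
  simp only [DFA.mem_accepts, DFA.eval]
  rw [h]

theorem Primrec.tableComp : Primrec₂ tableComp :=
  Primrec.list_map Primrec.fst
    ((Primrec.list_getD 0).comp (Primrec.snd.comp Primrec.fst) Primrec.snd).to₂

theorem Primrec.tableMap : Primrec₂ tableMap :=
  Primrec.list_map (Primrec.list_range.comp Primrec.fst)
    (Primrec.nat_mod.comp ((Primrec.list_getD 0).comp (Primrec.snd.comp Primrec.fst) Primrec.snd)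
      (Primrec.fst.comp Primrec.fst)).to₂

/-! ### Intersecting a multiple context-free language with a path language -/

theorem wordInterp_singleton {T : Type*} (w : List T) :
    wordInterp (fun t => [t]) [] (· ++ ·) w = w := by
  induction w with
  | nil => rfl
  | cons t w ih => exact congrArg (t :: ·) ih

namespace MCFGrammar

variable {T : Type*} {g : MCFGrammar T}

theorem ofFn_rank_initial {β : Type*} (b : β) :
    (List.ofFn fun _ : Fin (g.rank g.initial) => b) = [b] := by
  rw [List.ofFn_const, g.rank_initial]
  rfl

theorem exists_derives_initial_iff {β : Type*} {φ : List T → β} {b : β} :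
    (∃ A u, g.Derives A u ∧ (g.initial, [b]) = (A, List.ofFn fun j => φ (u j))) ↔
      ∃ w ∈ g.language, b = φ w := by
  constructor
  · rintro ⟨A, u, hu, h⟩
    obtain ⟨rfl, h⟩ := Prod.mk.inj h
    have : Subsingleton (Fin (g.rank g.initial)) := by rw [g.rank_initial]; infer_instance
    obtain ⟨j⟩ : Nonempty (Fin (g.rank g.initial)) := by rw [g.rank_initial]; infer_instance
    have hu' : u = fun _ => u j := funext fun i => congrArg u (Subsingleton.elim _ _)
    refine ⟨u j, show g.Derives _ _ from hu' ▸ hu, ?_⟩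
    rw [hu', ofFn_rank_initial] at h
    simpa using h
  · rintro ⟨w, hw, rfl⟩
    exact ⟨_, _, hw, by rw [ofFn_rank_initial]⟩

variable (g) {V : Type*} [Primcodable V] [Primcodable T] [Finite T]

/-- Here words are interpreted as themselves, in the free monoid, so the iterates enumerate derived
words and path labels; a common stage `k` serves for both. -/
theorem re_exists_mem_language_pathLanguage [Primcodable g.NT] :
    REPred fun x : List (V × List T × V) × List V × List V =>
      ∃ w ∈ g.language, w ∈ pathLanguage x.1 x.2.1 x.2.2 := by
  classical
  let σ : T → List T := fun t => [t]
  have hm : ∀ u v, wordInterp σ [] (· ++ ·) (u ++ v) =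
      wordInterp σ [] (· ++ ·) u ++ wordInterp σ [] (· ++ ·) v := fun u v => by
    simp only [σ, wordInterp_singleton]
  let I : List (V × List T × V) × List V × List V → ℕ → List (V × List T) := fun x k =>
    (pathStep σ [] (· ++ ·) x.1)^[k] (x.2.1.map fun p => (p, []))
  let F : ℕ → List (g.NT × List (List T)) := fun k => (g.step σ [] (· ++ ·))^[k] []
  have hI : Primrec₂ I := by
    refine Primrec.nat_iterate Primrec.snd (Primrec.list_map
      (Primrec.fst.comp (Primrec.snd.comp Primrec.fst))
      (Primrec.pair Primrec.snd (Primrec.const _)).to₂) ?_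
    exact ((Primrec.pathStep (P := Unit) (σ := fun _ => σ) (e := fun _ => [])
      (fun t => Primrec.const _) (Primrec.const _) Primrec.list_append).comp
      (Primrec.pair (Primrec.const ()) (Primrec.pair (Primrec.fst.comp (Primrec.fst.comp Primrec.fst))
        Primrec.snd))).to₂
  have hF : Primrec F := by
    refine Primrec.nat_iterate Primrec.id (Primrec.const _) ?_
    exact ((Primrec.mcfGrammar_step (P := Unit) (σ := fun _ => σ) (e := fun _ => [])
      (fun t => Primrec.const _) (Primrec.const _) Primrec.list_append).comp
      (Primrec.const ()) Primrec.snd).to₂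
  have hR : PrimrecRel fun (x : List (V × List T × V) × List V × List V) (k : ℕ) =>
      ∃ y ∈ I x k, y.1 ∈ x.2.2 ∧ (g.initial, [y.2]) ∈ F k := by
    have h : PrimrecRel fun (y : V × List T)
        (z : (List (V × List T × V) × List V × List V) × ℕ) =>
        y.1 ∈ z.1.2.2 ∧ (g.initial, [y.2]) ∈ F z.2 :=
      (PrimrecRel.list_mem.comp (Primrec.fst.comp Primrec.fst) (Primrec.snd.comp
        (Primrec.snd.comp (Primrec.fst.comp Primrec.snd)))).and
      (PrimrecRel.list_mem.comp (Primrec.pair (Primrec.const _) (Primrec.list_cons.comp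
        (Primrec.snd.comp Primrec.fst) (Primrec.const []))) (hF.comp (Primrec.snd.comp Primrec.snd)))
    exact h.exists_mem_list.comp hI Primrec.id
  refine (REPred.exists_of_primrecRel hR).of_eq fun x => ⟨?_, ?_⟩
  · rintro ⟨k, ⟨q, b⟩, hy, hq, hF⟩
    obtain ⟨p, hp, w, h, hb⟩ := (exists_labelledPath_iff_mem_iterate_pathStep hm).1 ⟨k, hy⟩
    obtain ⟨w', hw', hb'⟩ := exists_derives_initial_iff.1
      ((exists_derives_iff_mem_iterate_step hm).1 ⟨k, hF⟩)
    simp only [σ, wordInterp_singleton] at hb hb'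
    subst hb
    subst hb'
    exact ⟨_, hw', p, hp, q, hq, h⟩
  · rintro ⟨w, hw, p, hp, q, hq, h⟩
    obtain ⟨k, hk⟩ := (exists_labelledPath_iff_mem_iterate_pathStep (x := (q, w)) hm).2
      ⟨p, hp, w, h, (wordInterp_singleton w).symm⟩
    obtain ⟨l, hl⟩ := (exists_derives_iff_mem_iterate_step hm).2
      (exists_derives_initial_iff.2 ⟨w, hw, (wordInterp_singleton w).symm⟩)
    exact ⟨max k l, (q, w), subset_iterate (fun _ _ h => mem_pathStep.2 (Or.inl h))
      (le_max_left _ _) _ hk, hq, subset_iterate (fun _ _ h => mem_step.2 (Or.inl h))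
      (le_max_right _ _) _ hl⟩

theorem re_forall_mem_language_notMem_pathLanguage [Primcodable g.NT] :
    REPred fun x : List (V × List T × V) × List V × List V =>
      ¬ ∃ w ∈ g.language, w ∈ pathLanguage x.1 x.2.1 x.2.2 := by
  classical
  obtain ⟨N, ⟨ι⟩⟩ := Finite.exists_equiv_fin T
  let X := List (V × List T × V) × List V × List V
  let P := ℕ × List (List ℕ)
  let C := P × List (V × List ℕ) × List (g.NT × List (List ℕ))
  let σ : P → T → List ℕ := fun p t => tableMap p.1 (p.2.getD (ι t) [])
  let e : P → List ℕ := fun p => List.range p.1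
  have hm : ∀ (p : P) u v, wordInterp (σ p) (e p) tableComp (u ++ v) =
      tableComp (wordInterp (σ p) (e p) tableComp u) (wordInterp (σ p) (e p) tableComp v) :=
    fun p u v => wordInterp_tableMap_append p.1 (fun t => p.2.getD (ι t) []) u v
  have hσ : ∀ t, Primrec fun p => σ p t := fun t => Primrec.tableMap.comp Primrec.fst
    ((Primrec.list_getD _).comp Primrec.snd (Primrec.const _))
  have he : Primrec e := Primrec.list_range.comp Primrec.fst
  -- A certificate consists of a table, a list of (vertex, transformation) pairs and a list of
  -- (non-terminal, tuple of transformations) pairs. Both lists need only be closed, not minimal,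
  -- which makes the check primitive recursive.
  let R : X → C → Prop := fun x c =>
    (x.2.1.map fun p => (p, e c.1)) ⊆ c.2.1 ∧
    pathStep (σ c.1) (e c.1) tableComp x.1 c.2.1 ⊆ c.2.1 ∧
    g.step (σ c.1) (e c.1) tableComp c.2.2 ⊆ c.2.2 ∧
    ∀ y ∈ c.2.1, ¬ (y.1 ∈ x.2.2 ∧ (g.initial, [y.2]) ∈ c.2.2)
  have hR : PrimrecRel R := by
    have hx : Primrec fun z : X × C => z.1 := Primrec.fst
    have hp : Primrec fun z : X × C => z.2.1 := Primrec.fst.comp Primrec.snd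
    have hI : Primrec fun z : X × C => z.2.2.1 :=
      Primrec.fst.comp (Primrec.snd.comp Primrec.snd)
    have hF : Primrec fun z : X × C => z.2.2.2 :=
      Primrec.snd.comp (Primrec.snd.comp Primrec.snd)
    refine (PrimrecRel.list_subset.comp (Primrec.list_map
      (Primrec.fst.comp (Primrec.snd.comp hx))
      (Primrec.pair Primrec.snd (he.comp (hp.comp Primrec.fst))).to₂) hI).and ?_
    refine (PrimrecRel.list_subset.comp ((Primrec.pathStep hσ he Primrec.tableComp).comp
      (Primrec.pair hp (Primrec.pair (Primrec.fst.comp hx) hI))) hI).and ?_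
    refine (PrimrecRel.list_subset.comp
      ((Primrec.mcfGrammar_step hσ he Primrec.tableComp).comp hp hF) hF).and ?_
    have h : PrimrecRel fun (y : V × List ℕ) (z : X × C) =>
        ¬ (y.1 ∈ z.1.2.2 ∧ (g.initial, [y.2]) ∈ z.2.2.2) :=
      ((PrimrecRel.list_mem.comp (Primrec.fst.comp Primrec.fst) (Primrec.snd.comp
        (Primrec.snd.comp (hx.comp Primrec.snd)))).and
      (PrimrecRel.list_mem.comp (Primrec.pair (Primrec.const _) (Primrec.list_cons.comp
        (Primrec.snd.comp Primrec.fst) (Primrec.const []))) (hF.comp Primrec.snd))).not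
    exact h.forall_mem_list.comp hI Primrec.id
  refine (REPred.exists_of_primrecRel hR).of_eq fun x => ⟨?_, fun hx => ?_⟩
  · rintro ⟨⟨p, I, F⟩, hst, hI, hF, hno⟩ ⟨w, hw, v, hv, q, hq, h⟩
    refine hno _ (h.mem_of_pathStep_subset (hm p) hI (hst (List.mem_map.2 ⟨v, hv, rfl⟩))) ⟨hq, ?_⟩
    have := Derives.mem_of_step_subset (hm p) hF hw
    rwa [ofFn_rank_initial] at this
  · obtain ⟨n, δ, hδ⟩ := (isRegular_pathLanguage x.1 x.2.1 x.2.2).exists_table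
    let p : P := (n, List.ofFn fun i => δ (ι.symm i))
    have hσp : σ p = fun t => tableMap n (δ t) := by
      funext t
      simp [σ, p]
    have hfin : (Set.range (wordInterp (σ p) (e p) tableComp)).Finite := by
      rw [hσp]
      exact finite_range_wordInterp_tableMap n δ
    obtain ⟨F, hF⟩ := exists_list_mem_iff_derives (g := g) hfin
    -- The exact set of values of path labels, finite because the reached vertices are start
    -- vertices or edge targets.
    have hIfin : {y : V × List ℕ | ∃ v ∈ x.2.1, ∃ w, LabelledPath x.1 v w y.1 ∧
        y.2 = wordInterp (σ p) (e p) tableComp w}.Finite := by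
      refine Set.Finite.subset (((x.2.1 ++ x.1.map fun a => a.2.2).finite_toSet).prod hfin) ?_
      rintro ⟨q, b⟩ ⟨v, hv, w, h, rfl⟩
      refine ⟨?_, w, rfl⟩
      cases h with
      | nil => exact List.mem_append_left _ hv
      | snoc _ hu => exact List.mem_append_right _ (List.mem_map.2 ⟨_, hu, rfl⟩)
    refine ⟨(p, hIfin.toFinset.toList, F), ?_, ?_, ?_, ?_⟩
    · intro y hy
      obtain ⟨v, hv, rfl⟩ := List.mem_map.1 hy
      simp only [Finset.mem_toList, Set.Finite.mem_toFinset]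
      exact ⟨v, hv, [], .nil _, rfl⟩
    · intro y hy
      simp only [mem_pathStep, Finset.mem_toList, Set.Finite.mem_toFinset] at hy ⊢
      rcases hy with hy | ⟨q, u, r, b, hu, ⟨v, hv, w, h, hb⟩, rfl⟩
      · exact hy
      · refine ⟨v, hv, w ++ u, h.snoc hu, ?_⟩
        simp only at hb
        rw [hm, hb]
    · intro y hy
      exact (hF y).2 (exists_derives_of_mem_step (hm p) (fun y hy => (hF y).1 hy) hy)
    · rintro ⟨q, b⟩ hy ⟨hq, hb⟩
      simp only [Finset.mem_toList, Set.Finite.mem_toFinset] at hy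
      obtain ⟨v, hv, w, h, hbw⟩ := hy
      obtain ⟨w', hw', hbw'⟩ := exists_derives_initial_iff.1 ((hF _).1 hb)
      -- A derived word `w'` and a path label `w` inducing the same transformation lie in the path
      -- language together, contrary to `hx`.
      refine hx ⟨w', hw', (hδ w w' ?_).1 ⟨v, hv, q, hq, h⟩⟩
      have := hbw.symm.trans hbw'
      rwa [hσp] at this

/-- It is decidable whether a fixed multiple context-free language meets the path language of a
given graph. -/
theorem computablePred_exists_mem_language_pathLanguage :
    ComputablePred fun x : List (V × List T × V) × List V × List V =>
      ∃ w ∈ g.language, w ∈ pathLanguage x.1 x.2.1 x.2.2 := by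
  have := g.finite_NT
  obtain ⟨n, ⟨f⟩⟩ := Finite.exists_equiv_fin g.NT
  let _ : Primcodable g.NT := Primcodable.ofEquiv _ f
  exact ComputablePred.computable_iff_re_compl_re'.2
    ⟨g.re_exists_mem_language_pathLanguage, g.re_forall_mem_language_notMem_pathLanguage⟩

end MCFGrammar

/-! ### Comparing the values of two path languages in a group -/

section PairGraph

variable {G α T V : Type*} [Group G]

theorem wordValue_append (π : α → G) (u v : List α) :
    wordValue π (u ++ v) = wordValue π u * wordValue π v := by
  simp [wordValue]

theorem wordValue_flatMap {π : α → G} {ρ : T → G} {γ : α → List T}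
    (hγ : ∀ a, wordValue ρ (γ a) = π a) (u : List α) :
    wordValue ρ (u.flatMap γ) = wordValue π u := by
  induction u with
  | nil => rfl
  | cons a u ih => rw [List.flatMap_cons, wordValue_append, hγ, ih]; simp [wordValue]

theorem wordValue_reverse_flatMap {π : α → G} {ρ : T → G} {γ : α → List T}
    (hγ : ∀ a, wordValue ρ (γ a) = (π a)⁻¹) (u : List α) :
    wordValue ρ (u.reverse.flatMap γ) = (wordValue π u)⁻¹ := by
  rw [wordValue_flatMap (π := fun a => (π a)⁻¹) hγ]
  simp [wordValue, List.prod_inv_reverse, Function.comp_def]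

/-- The graph whose paths run through a path of the first graph and then through the reverse of a
path of the second one, letters being replaced by `γ` and `γ'` respectively. -/
def pairGraph (γ γ' : α → List T) (E₁ : List (V × List α × V)) (ac₁ : List V)
    (E₂ : List (V × List α × V)) (ac₂ : List V) : List ((V ⊕ V) × List T × (V ⊕ V)) :=
  (E₁.map fun a => (Sum.inl a.1, a.2.1.flatMap γ, Sum.inl a.2.2)) ++
  (E₂.map fun a => (Sum.inr a.2.2, a.2.1.reverse.flatMap γ', Sum.inr a.1)) ++
  ac₁.flatMap fun p => ac₂.map fun q => (Sum.inl p, [], Sum.inr q)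

variable {π : α → G} {ρ : T → G} {γ γ' : α → List T}
  (hγ : ∀ a, wordValue ρ (γ a) = π a) (hγ' : ∀ a, wordValue ρ (γ' a) = (π a)⁻¹)
  {E₁ E₂ : List (V × List α × V)} {ac₁ ac₂ : List V}

theorem mem_pairGraph {x : (V ⊕ V) × List T × (V ⊕ V)} :
    x ∈ pairGraph γ γ' E₁ ac₁ E₂ ac₂ ↔
      (∃ p u q, (p, u, q) ∈ E₁ ∧ x = (Sum.inl p, u.flatMap γ, Sum.inl q)) ∨
      (∃ p u q, (p, u, q) ∈ E₂ ∧ x = (Sum.inr q, u.reverse.flatMap γ', Sum.inr p)) ∨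
      ∃ p ∈ ac₁, ∃ q ∈ ac₂, x = (Sum.inl p, [], Sum.inr q) := by
  simp only [pairGraph, List.mem_append, List.mem_map, List.mem_flatMap, Prod.exists, or_assoc,
    @eq_comm _ _ x]

include hγ hγ'

/-- Paths cross from the left copy to the right one at most once. Left of the crossing the label
spells `u`. Beyond it, edges of the second graph are run backwards from an accepting vertex, so `v`
grows at its front and its inverse value grows at the end. -/
theorem LabelledPath.of_pairGraph {p : V} {w : List T} {c : V ⊕ V}
    (h : LabelledPath (pairGraph γ γ' E₁ ac₁ E₂ ac₂) (Sum.inl p) w c) :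
    (∀ q, c = Sum.inl q → ∃ u, LabelledPath E₁ p u q ∧ wordValue ρ w = wordValue π u) ∧
    ∀ q, c = Sum.inr q → ∃ f₁ ∈ ac₁, ∃ f₂ ∈ ac₂, ∃ u v, LabelledPath E₁ p u f₁ ∧
      LabelledPath E₂ q v f₂ ∧ wordValue ρ w = wordValue π u * (wordValue π v)⁻¹ := by
  induction h with
  | nil =>
    refine ⟨?_, fun q h => by cases h⟩
    rintro q ⟨⟩
    exact ⟨[], .nil _, rfl⟩
  | snoc h hu ih =>
    rcases mem_pairGraph.1 hu with ⟨q, u, r, hE, hx⟩ | ⟨r, u, q, hE, hx⟩ | ⟨f₁, h₁, f₂, h₂, hx⟩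
    · cases hx
      refine ⟨?_, fun q h => by cases h⟩
      rintro r' ⟨⟩
      obtain ⟨u', hu', hw⟩ := ih.1 q rfl
      exact ⟨u' ++ u, hu'.snoc hE, by
        rw [wordValue_append, wordValue_append, hw, wordValue_flatMap hγ]⟩
    · cases hx
      refine ⟨fun q h => by (cases h), ?_⟩
      rintro r' ⟨⟩
      obtain ⟨f₁, h₁, f₂, h₂, u', v', hu', hv', hw⟩ := ih.2 q rfl
      refine ⟨f₁, h₁, f₂, h₂, u', u ++ v', hu', hv'.cons hE, ?_⟩
      rw [wordValue_append, wordValue_append, hw, wordValue_reverse_flatMap hγ', mul_inv_rev,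
        mul_assoc]
    · cases hx
      refine ⟨fun q h => by (cases h), ?_⟩
      rintro r' ⟨⟩
      obtain ⟨u, hu, hw⟩ := ih.1 f₁ rfl
      exact ⟨f₁, h₁, f₂, h₂, u, [], hu, .nil _, by simpa [wordValue] using hw⟩

theorem exists_mem_pathLanguage_pairGraph_iff {st₁ st₂ : List V} :
    (∃ w, wordValue ρ w = 1 ∧ w ∈ pathLanguage (pairGraph γ γ' E₁ ac₁ E₂ ac₂)
      (st₁.map Sum.inl) (st₂.map Sum.inr)) ↔
    ∃ u ∈ pathLanguage E₁ st₁ ac₁, ∃ v ∈ pathLanguage E₂ st₂ ac₂,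
      wordValue π u = wordValue π v := by
  constructor
  · rintro ⟨w, hw, p, hp, q, hq, h⟩
    obtain ⟨p, hp₁, rfl⟩ := List.mem_map.1 hp
    obtain ⟨q, hq₂, rfl⟩ := List.mem_map.1 hq
    obtain ⟨f₁, h₁, f₂, h₂, u, v, hu, hv, huv⟩ := (h.of_pairGraph hγ hγ').2 q rfl
    exact ⟨u, ⟨p, hp₁, f₁, h₁, hu⟩, v, ⟨q, hq₂, f₂, h₂, hv⟩, mul_inv_eq_one.1 (huv.symm.trans hw)⟩
  · rintro ⟨u, ⟨p, hp, f₁, h₁, hu⟩, v, ⟨q, hq, f₂, h₂, hv⟩, huv⟩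
    have hu' : LabelledPath (pairGraph γ γ' E₁ ac₁ E₂ ac₂) (Sum.inl p) (u.flatMap γ)
        (Sum.inl f₁) := by
      clear huv h₁
      induction hu with
      | nil => exact .nil _
      | snoc h hE ih =>
        rw [List.flatMap_append]
        exact ih.snoc (mem_pairGraph.2 (Or.inl ⟨_, _, _, hE, rfl⟩))
    have hv' : LabelledPath (pairGraph γ γ' E₁ ac₁ E₂ ac₂) (Sum.inr f₂) (v.reverse.flatMap γ')
        (Sum.inr q) := by
      clear huv h₂
      induction hv with
      | nil => exact .nil _
      | snoc h hE ih =>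
        rw [List.reverse_append, List.flatMap_append]
        exact ih.cons (mem_pairGraph.2 (Or.inr (Or.inl ⟨_, _, _, hE, rfl⟩)))
    refine ⟨_, ?_, _, List.mem_map.2 ⟨p, hp, rfl⟩, _, List.mem_map.2 ⟨q, hq, rfl⟩,
      (hu'.snoc (mem_pairGraph.2 (Or.inr (Or.inr ⟨f₁, h₁, f₂, h₂, rfl⟩)))).trans hv'⟩
    rw [List.append_nil, wordValue_append, wordValue_flatMap hγ, wordValue_reverse_flatMap hγ',
      huv, mul_inv_cancel]

end PairGraph

theorem Primrec.pairGraph {α T V : Type*} [Primcodable α] [Finite α] [Primcodable T]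
    [Primcodable V] (γ γ' : α → List T) :
    Primrec fun x : (List (V × List α × V) × List V) × List (V × List α × V) × List V =>
      _root_.pairGraph γ γ' x.1.1 x.1.2 x.2.1 x.2.2 := by
  have h₁ : Primrec fun y : ((List (V × List α × V) × List V) × List (V × List α × V) × List V) ×
      V × List α × V => y.2.1 := Primrec.fst.comp Primrec.snd
  have h₂ : Primrec fun y : ((List (V × List α × V) × List V) × List (V × List α × V) × List V) ×
      V × List α × V => y.2.2.1 := Primrec.fst.comp (Primrec.snd.comp Primrec.snd)
  have h₃ : Primrec fun y : ((List (V × List α × V) × List V) × List (V × List α × V) × List V) ×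
      V × List α × V => y.2.2.2 := Primrec.snd.comp (Primrec.snd.comp Primrec.snd)
  refine Primrec.list_append.comp (Primrec.list_append.comp
    (Primrec.list_map (Primrec.fst.comp Primrec.fst) ?_)
    (Primrec.list_map (Primrec.fst.comp Primrec.snd) ?_))
    (Primrec.list_flatMap (Primrec.snd.comp Primrec.fst)
      (Primrec.list_map (Primrec.snd.comp (Primrec.snd.comp Primrec.fst)) ?_))
  · exact Primrec.pair (Primrec.sumInl.comp h₁) (Primrec.pair (Primrec.list_flatMap h₂
      ((Primrec.dom_finite γ).comp Primrec.snd).to₂) (Primrec.sumInl.comp h₃))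
  · exact Primrec.pair (Primrec.sumInr.comp h₃) (Primrec.pair (Primrec.list_flatMap
      (Primrec.list_reverse.comp h₂) ((Primrec.dom_finite γ').comp Primrec.snd).to₂)
      (Primrec.sumInr.comp h₁))
  · exact Primrec.pair (Primrec.sumInl.comp (Primrec.snd.comp Primrec.fst))
      (Primrec.pair (Primrec.const _) (Primrec.sumInr.comp Primrec.snd))

/-- If a word problem of a group is multiple context-free, then it is decidable whether two path
languages have values in common. -/
theorem computablePred_exists_wordValue_eq {G : Type*} [Group G] {X : Set G} (hX : X.Finite)
    (hgen : Subgroup.closure X = ⊤) (hWP : (wordProblem X).IsMultipleContextFree)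
    {α V : Type*} [Finite α] [Primcodable α] [Primcodable V] (π : α → G) :
    ComputablePred fun x : (List (V × List α × V) × List V × List V) ×
        List (V × List α × V) × List V × List V =>
      ∃ u ∈ pathLanguage x.1.1 x.1.2.1 x.1.2.2, ∃ v ∈ pathLanguage x.2.1 x.2.2.1 x.2.2.2,
        wordValue π u = wordValue π v := by
  obtain ⟨k, -, g, -, hg⟩ := hWP
  have hfin : Finite ↥(X ∪ X⁻¹) := (hX.union hX.inv).to_subtype
  obtain ⟨n, ⟨f⟩⟩ := Finite.exists_equiv_fin ↥(X ∪ X⁻¹)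
  let _ : Primcodable ↥(X ∪ X⁻¹) := Primcodable.ofEquiv _ f
  have hword : ∀ x : G, ∃ w : List ↥(X ∪ X⁻¹), wordValue Subtype.val w = x := by
    intro x
    have hx : x ∈ Submonoid.closure (X ∪ X⁻¹) := by
      rw [← Subgroup.closure_toSubmonoid, hgen]
      trivial
    obtain ⟨l, hl, rfl⟩ := Submonoid.exists_list_of_mem_closure hx
    lift l to List ↥(X ∪ X⁻¹) using hl
    exact ⟨l, rfl⟩
  -- As `α` is finite, these choices are finite tables, hence harmless for computability.
  choose γ hγ using fun a => hword (π a)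
  choose γ' hγ' using fun a => hword (π a)⁻¹
  refine ComputablePred.computable_of_manyOneReducible ⟨fun x =>
    (pairGraph γ γ' x.1.1 x.1.2.2 x.2.1 x.2.2.2, x.1.2.1.map Sum.inl, x.2.2.1.map Sum.inr),
    ?_, fun x => ?_⟩ (g.computablePred_exists_mem_language_pathLanguage (V := V ⊕ V))
  · refine Primrec.to_comp (Primrec.pair ((Primrec.pairGraph γ γ').comp
      (f := fun x => _root_.pairGraph γ γ' x.1.1 x.1.2 x.2.1 x.2.2)
      (g := fun x : (List (V × List α × V) × List V × List V) ×
        List (V × List α × V) × List V × List V => ((x.1.1, x.1.2.2), (x.2.1, x.2.2.2)))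
      (Primrec.pair (Primrec.pair ?_ ?_) (Primrec.pair ?_ ?_))) (Primrec.pair
        (Primrec.list_map ?_ (Primrec.sumInl.comp Primrec.snd).to₂)
        (Primrec.list_map ?_ (Primrec.sumInr.comp Primrec.snd).to₂)))
    · exact Primrec.fst.comp Primrec.fst
    · exact Primrec.snd.comp (Primrec.snd.comp Primrec.fst)
    · exact Primrec.fst.comp Primrec.snd
    · exact Primrec.snd.comp (Primrec.snd.comp Primrec.snd)
    · exact Primrec.fst.comp (Primrec.snd.comp Primrec.fst)
    · exact Primrec.fst.comp (Primrec.snd.comp Primrec.snd)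
  · rw [hg]
    exact (exists_mem_pathLanguage_pairGraph_iff hγ hγ').symm

/-! ### Automata as labelled graphs -/

namespace FSA

variable {α : Type*}

/-- The graph of an automaton with its start and accept vertices. -/
def toGraph (A : FSA α) : List (ℕ × List α × ℕ) × List ℕ × List ℕ :=
  ((A.trans.filter fun a => a.1 < A.numStates ∧ a.2.2 < A.numStates).map
      fun a => (a.1, a.2.1.toList, a.2.2),
    A.start.filter (· < A.numStates), A.accept)

theorem mem_toGraph_fst {A : FSA α} {x : ℕ × List α × ℕ} : x ∈ A.toGraph.1 ↔
    ∃ p a q, (p, a, q) ∈ A.trans ∧ p < A.numStates ∧ q < A.numStates ∧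
      x = (p, a.toList, q) := by
  simp [toGraph, @eq_comm _ _ x, and_assoc]

theorem isPath_iff_labelledPath {A : FSA α} {p q : Fin A.numStates} {w : List α} :
    (∃ x : List (Option α), x.reduceOption = w ∧ A.toεNFA.IsPath p q x) ↔
      LabelledPath A.toGraph.1 p w q := by
  constructor
  · rintro ⟨x, rfl, h⟩
    induction h with
    | nil p => exact .nil _
    | cons q p r a x hstep h ih =>
      have : (a :: x).reduceOption = a.toList ++ x.reduceOption := by cases a <;> simp
      rw [this]
      exact ih.cons (mem_toGraph_fst.2 ⟨p, a, q, hstep, p.2, q.2, rfl⟩)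
  · intro h
    generalize hr : (q : ℕ) = r at h
    induction h generalizing q with
    | nil => exact ⟨[], rfl, by rw [Fin.ext hr]; exact .nil _⟩
    | @snoc s _ _ _ h hu ih =>
      obtain ⟨p', a, q', ha, hp', hq', hx⟩ := mem_toGraph_fst.1 hu
      cases hx
      obtain ⟨x, rfl, hx⟩ := ih (q := ⟨s, hp'⟩) rfl
      refine ⟨x ++ [a], ?_, (εNFA.isPath_append _).2 ⟨_, hx, (εNFA.isPath_singleton _).2 ?_⟩⟩
      · cases a <;> simp [List.reduceOption_append]
      · subst hr
        exact ha

theorem mem_language_iff {A : FSA α} {w : List α} :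
    w ∈ A.language ↔ w ∈ pathLanguage A.toGraph.1 A.toGraph.2.1 A.toGraph.2.2 := by
  rw [language, εNFA.mem_accepts_iff_exists_path]
  constructor
  · rintro ⟨p, q, x, hp, hq, hx, h⟩
    exact ⟨p, List.mem_filter.2 ⟨hp, by simp⟩, q, hq, isPath_iff_labelledPath.1 ⟨x, hx, h⟩⟩
  · rintro ⟨p, hp, q, hq, h⟩
    obtain ⟨hp, hpn⟩ := List.mem_filter.1 hp
    have hpn : p < A.numStates := of_decide_eq_true hpn
    -- Accepting vertices are not filtered in `toGraph`: a path from a valid start vertex never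
    -- leaves the valid states.
    have hqn : q < A.numStates := by
      cases h with
      | nil => exact hpn
      | snoc _ hu =>
        obtain ⟨_, _, _, _, _, hq', hx⟩ := mem_toGraph_fst.1 hu
        cases hx
        exact hq'
    obtain ⟨x, hx, h⟩ := (isPath_iff_labelledPath (p := ⟨p, hpn⟩) (q := ⟨q, hqn⟩)).2 h
    exact ⟨_, _, x, hp, hq, hx, h⟩

theorem primrec_toGraph [Primcodable α] : Primrec (toGraph : FSA α → _) := by
  have h : Primrec (equivProd α) := Primrec.of_equiv
  have hn : Primrec (numStates : FSA α → ℕ) := Primrec.fst.comp h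
  have hs : Primrec (start : FSA α → List ℕ) := Primrec.fst.comp (Primrec.snd.comp h)
  have ha : Primrec (accept : FSA α → List ℕ) :=
    Primrec.fst.comp (Primrec.snd.comp (Primrec.snd.comp h))
  have ht : Primrec (trans : FSA α → List (ℕ × Option α × ℕ)) :=
    Primrec.snd.comp (Primrec.snd.comp (Primrec.snd.comp h))
  refine Primrec.pair (Primrec.list_map ?_ ?_) (Primrec.pair ?_ ha)
  · refine (PrimrecRel.listFilter (R := fun (a : ℕ × Option α × ℕ) (n : ℕ) =>
      a.1 < n ∧ a.2.2 < n) ?_).comp ht hn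
    exact (Primrec.nat_lt.comp (Primrec.fst.comp Primrec.fst) Primrec.snd).and
      (Primrec.nat_lt.comp (Primrec.snd.comp (Primrec.snd.comp Primrec.fst)) Primrec.snd)
  · exact (Primrec.pair (Primrec.fst.comp Primrec.snd) (Primrec.pair
      (Primrec.optionToList.comp (Primrec.fst.comp (Primrec.snd.comp Primrec.snd)))
      (Primrec.snd.comp (Primrec.snd.comp Primrec.snd)))).to₂
  · exact (PrimrecRel.listFilter (R := fun a n : ℕ => a < n) Primrec.nat_lt).comp hs hn

end FSA

theorem mem_pathLanguage_singleton {α : Type*} {u w : List α} :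
    u ∈ pathLanguage [(0, w, 1)] [0] [1] ↔ u = w := by
  constructor
  · rintro ⟨p, hp, q, hq, h⟩
    rw [List.mem_singleton] at hp hq
    subst hp hq
    cases h with
    | snoc h hu =>
      cases List.mem_singleton.1 hu
      cases h with
      | nil => rfl
      | snoc _ hu => cases List.mem_singleton.1 hu
  · rintro rfl
    exact ⟨0, by simp, 1, by simp, .snoc (.nil _) (List.mem_singleton.2 rfl)⟩

/-! ### The three decision problems. -/

section Group

variable {G : Type*} [Group G] {X : Set G} (hX : X.Finite) (hgen : Subgroup.closure X = ⊤)
  (hWP : (wordProblem X).IsMultipleContextFree) {α : Type*} [Finite α] [Primcodable α] (π : α → G)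
include hX hgen hWP

/-- The word is encoded as a graph with a single edge, whose path language is a singleton. -/
theorem decidableRationalMembership_of_wordProblem : DecidableRationalMembership π := by
  refine ComputablePred.computable_of_manyOneReducible
    ⟨fun p => (p.1.toGraph, ([(0, p.2, 1)], ([0], [1]))), ?_, fun p => ?_⟩
    (computablePred_exists_wordValue_eq (V := ℕ) hX hgen hWP π)
  · refine Primrec.to_comp (Primrec.pair (FSA.primrec_toGraph.comp Primrec.fst)
      (Primrec.pair ?_ (Primrec.const _)))
    exact Primrec.list_cons.comp (Primrec.pair (Primrec.const _)
      (Primrec.pair Primrec.snd (Primrec.const _))) (Primrec.const [])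
  · simp only [mem_pathLanguage_singleton, exists_eq_left, ← FSA.mem_language_iff]
    rfl

theorem decidableRationalIntersection_of_wordProblem : DecidableRationalIntersection π := by
  refine ComputablePred.computable_of_manyOneReducible
    ⟨fun p => (p.1.toGraph, p.2.toGraph), ?_, fun p => ?_⟩
    (computablePred_exists_wordValue_eq (V := ℕ) hX hgen hWP π).not
  · exact Primrec.to_comp (Primrec.pair (FSA.primrec_toGraph.comp Primrec.fst)
      (FSA.primrec_toGraph.comp Primrec.snd))
  · simp only [← FSA.mem_language_iff]
    rw [← Set.not_nonempty_iff_eq_empty, not_iff_not]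
    constructor
    · rintro ⟨_, ⟨u, hu, rfl⟩, ⟨v, hv, huv⟩⟩
      exact ⟨u, hu, v, hv, huv.symm⟩
    · rintro ⟨u, hu, v, hv, huv⟩
      exact ⟨_, ⟨u, hu, rfl⟩, ⟨v, hv, huv.symm⟩⟩

/-- This is rational membership for the empty word, whose value is `1`, over the alphabet `Y ∪ Y⁻¹`.
-/
theorem decidableRegularIntersection_of_wordProblem {Y : Set G} (hY : Y.Finite)
    [Primcodable ↥(Y ∪ Y⁻¹)] : DecidableRegularIntersection (wordProblem Y) := by
  have : Finite ↥(Y ∪ Y⁻¹) := (hY.union hY.inv).to_subtype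
  refine ComputablePred.computable_of_manyOneReducible ⟨fun A => (A, []), ?_, fun A => ?_⟩
    (decidableRationalMembership_of_wordProblem hX hgen hWP (Subtype.val : ↥(Y ∪ Y⁻¹) → G))
  · exact Primrec.to_comp (Primrec.pair Primrec.id (Primrec.const _))
  · exact ⟨fun ⟨w, h₁, h₂⟩ => ⟨w, h₂, h₁⟩, fun ⟨w, h₂, h₁⟩ => ⟨w, h₁, h₂⟩⟩

end Group

/-- The hypothesis is about one finite generating set `X` of the group `G`; the conclusions hold for
every finite alphabet `α` with a generating map to `G` and for every finite generating set `Y`.  The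
encoding of the letters of a finite alphabet by numbers (`Primcodable`) is arbitrary. -/
theorem lemma6p1 {G : Type*} [Group G] (X : Set G) (hX : X.Finite)
    (hgen : Subgroup.closure X = ⊤) (hWP : (wordProblem X).IsMultipleContextFree) :
    (∀ (α : Type*) [Finite α] [Primcodable α] (π : α → G), IsGeneratingMap π →
        DecidableRationalMembership π) ∧
    (∀ (α : Type*) [Finite α] [Primcodable α] (π : α → G), IsGeneratingMap π →
        DecidableRationalIntersection π) ∧
    (∀ Y : Set G, Y.Finite → Subgroup.closure Y = ⊤ → ∀ [Primcodable ↥(Y ∪ Y⁻¹)],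
        DecidableRegularIntersection (wordProblem Y)) :=
  ⟨fun _ _ _ π _ => decidableRationalMembership_of_wordProblem hX hgen hWP π,
    fun _ _ _ π _ => decidableRationalIntersection_of_wordProblem hX hgen hWP π,
    fun _ hY _ _ => decidableRegularIntersection_of_wordProblem hX hgen hWP hY⟩
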